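/- **Setting.** A network is a finite directed graph $G(V,E)$ (parallel links allowed) in which every link $e$ has a failure probability $p_e\in(0,p_{\max}]$, where $p_{\max}<1$, and a weight $w_e>0$. Put $S_{\min}=(1-p_{\max})^{|E|}$. For nodes $s,t$, a *survivable connection* is a pair $(\pi_1,\pi_2)$ of simple paths from $s$ to $t$ (not necessarily distinct); its *survivability level* is $\prod_{e\in\pi_1\cap\pi_2}(1-p_e)$ (equal to $1$ if there is no common link), its *CO-weight* is $\sum_{e\in\pi_1\cup\pi_2}w_e$ and its *CT-weight* is $\sum_{e\in\pi_1}w_e+\sum_{e\in\pi_2}w_e$. For $S\in[S_{\min},1]$, the *CO-CSMQ problem* (respectively *CT-CSMQ problem*) asks for a survivable connection of minimum CO-weight (respectively CT-weight) among those of survivability level at least $S$. **CO-TSCMQ algorithm.** (1) Build the transformed network $\tilde G$ on the node set $V$. Every link $e:u\to v$ of $G$ gives a *simple link* $u\to v$ of length $w_e$ and time $-\ln(1-p_e)$. For all $u,v\in V$ between which there are two edge-disjoint simple paths, choose such a pair of minimum total weight and add a *disjoint link* $u\to v$ whose length is this total weight and whose time is $0$. (2) Find a path $\tilde\pi$ from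 $s$ to $t$ in $\tilde G$ (nodes may repeat) of minimum total length among those of total time at most $-\ln S$; if no path from $s$ to $t$ has total time at most $-\ln S$, return Fail. (3) Return the pair $(\pi_1,\pi_2)$ obtained by traversing $\tilde\pi$: for a simple link, append the corresponding link of $G$ to both $\pi_1$ and $\pi_2$; for a disjoint link, append one path of its pair to $\pi_1$ and the other one to $\pi_2$. **CT-TSCMQ algorithm.** (0) Find a path $\pi_{\min}$ of minimum weight from $s$ to $t$ in $G$; if there is no path from $s$ to $t$, return Fail. Then run (1)–(3) with the following changes in (1): simple links are built only for the links of $\pi_{\min}$, disjoint links only between nodes $u,v$ of $\pi_{\min}$ (their pairs of paths still being taken in $G$), and the length of a simple link is $2w_e$. The minimization subproblems are solved exactly. Ties among minimizers, and the assignment of the two paths of a disjoint link to $\pi_1$ and $\pi_2$, may be resolved arbitrarily. **Theorem.** Let $G(V,E)$ be a network, $s,t\in V$ and $S\in[S_{\min},1]$. However ties are resolved: 1. The CO-TSCMQ algorithm always produces an outcome. If there is a survivable connection of survivability level at least $S$, then it returns a survivable connection that is an optimal solution of the CO-CSMQ problem; otherwise it returns Fail. 2. The CT-TSCMQ algorithm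 always produces an outcome. If there is a survivable connection of survivability level at least $S$, then it returns a survivable connection that is an optimal solution of the CT-CSMQ problem; otherwise it returns Fail. -/

import Mathlib

/-- A directed (multi)graph on the nodes `V` with links `E`: the link `e` goes from `src e` to
`tgt e`. A set of links `E ⊆ V × V` is the special case in which `(src, tgt)` is injective; parallel
links are allowed because the transformed network below needs them. -/
structure LinkGraph (V E : Type*) where
  src : E → V
  tgt : E → V

namespace LinkGraph

variable {V E : Type*}

/-- A path from `u` to `v` (nodes may repeat), given by the sequence of its links. -/
def IsPath (G : LinkGraph V E) : V → V → List E → Prop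
  | u, v, [] => u = v
  | u, v, e :: π => G.src e = u ∧ G.IsPath (G.tgt e) v π

/-- The sequence of nodes visited by a path that starts at `u`. -/
def nodes (G : LinkGraph V E) (u : V) (π : List E) : List V :=
  u :: π.map G.tgt

/-- `π` is a simple path from `u` to `v`, i.e. a member of `P^(u,v)`. -/
def IsSimplePath (G : LinkGraph V E) (u v : V) (π : List E) : Prop :=
  G.IsPath u v π ∧ (G.nodes u π).Nodup

end LinkGraph

/-- `a` minimizes `cost` among the feasible objects. -/
def IsMinimizer {α : Type*} (feas : α → Prop) (cost : α → ℝ) (a : α) : Prop :=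
  feas a ∧ ∀ b, feas b → cost a ≤ cost b

/-- The possible answers of an exact procedure for the problem "minimize `cost` subject to `feas`":
an arbitrary minimizer, or `none` if there is no feasible object. -/
def IsMinOutput {α : Type*} (feas : α → Prop) (cost : α → ℝ) : Option α → Prop
  | none => ∀ a, ¬ feas a
  | some a => IsMinimizer feas cost a

/-- Sum of an additive metric over the links of a path. -/
noncomputable def pathSum {E : Type*} (f : E → ℝ) (π : List E) : ℝ :=
  (π.map f).sum

/-- The Restricted Shortest Path problem with lengths `l`, times `τ` and bound `T`:
`o` is a path from `s` to `t` of minimum length among those of time at most `T`,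
or `none` if no path from `s` to `t` has time at most `T`. -/
def IsRSPOutput {V E : Type*} (G : LinkGraph V E) (l τ : E → ℝ) (T : ℝ) (s t : V)
    (o : Option (List E)) : Prop :=
  IsMinOutput (fun π => G.IsPath s t π ∧ pathSum τ π ≤ T) (pathSum l) o

/-- A network: every link has a failure probability `p e ∈ (0, pmax]`, `pmax < 1`, and a positive
weight `w e`. -/
structure Network (V E : Type*) extends LinkGraph V E where
  p : E → ℝ
  w : E → ℝ
  pmax : ℝ
  p_pos : ∀ e, 0 < p e
  p_le : ∀ e, p e ≤ pmax
  pmax_lt_one : pmax < 1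
  w_pos : ∀ e, 0 < w e

namespace Network

variable {V E : Type*}

/-- Minimum network success probability `(1 - pmax) ^ M`. -/
noncomputable def Smin [Fintype E] (N : Network V E) : ℝ :=
  (1 - N.pmax) ^ Fintype.card E

/-- A survivable connection: a pair of simple paths from `s` to `t`. -/
def IsSurvivableConnection (N : Network V E) (s t : V) (c : List E × List E) : Prop :=
  N.IsSimplePath s t c.1 ∧ N.IsSimplePath s t c.2

/-- Probability that all common links are operational (`1` if there is no common link). -/
noncomputable def survivability [DecidableEq E] (N : Network V E) (c : List E × List E) : ℝ :=
  ∏ e ∈ c.1.toFinset ∩ c.2.toFinset, (1 - N.p e)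

/-- CO-weight: common links are counted once. -/
noncomputable def coWeight [DecidableEq E] (N : Network V E) (c : List E × List E) : ℝ :=
  ∑ e ∈ c.1.toFinset ∪ c.2.toFinset, N.w e

/-- CT-weight: common links are counted twice. -/
noncomputable def ctWeight (N : Network V E) (c : List E × List E) : ℝ :=
  pathSum N.w c.1 + pathSum N.w c.2

/-- The constraint of the Constrained Survivability Min-QoS problems. -/
def IsSurvivableAtLevel [DecidableEq E] (N : Network V E) (s t : V) (S : ℝ)
    (c : List E × List E) : Prop :=
  N.IsSurvivableConnection s t c ∧ S ≤ N.survivability c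

/-- `c` solves the CO-Constrained Survivability Min-QoS problem. -/
def IsCOCSMQSolution [DecidableEq E] (N : Network V E) (s t : V) (S : ℝ)
    (c : List E × List E) : Prop :=
  IsMinimizer (N.IsSurvivableAtLevel s t S) N.coWeight c

/-- `c` solves the CT-Constrained Survivability Min-QoS problem. -/
def IsCTCSMQSolution [DecidableEq E] (N : Network V E) (s t : V) (S : ℝ)
    (c : List E × List E) : Prop :=
  IsMinimizer (N.IsSurvivableAtLevel s t S) N.ctWeight c

/-- A pair of link-disjoint (simple) paths from `u` to `v`. -/
def IsEdgeDisjointPair (N : Network V E) (u v : V) (q : List E × List E) : Prop :=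
  N.IsSimplePath u v q.1 ∧ N.IsSimplePath u v q.2 ∧ q.1.Disjoint q.2

/-- Possible answers of an Edge-Disjoint Shortest Pair procedure: a pair of link-disjoint paths from
`u` to `v` of minimum total weight, or `none` if there is no link-disjoint pair. -/
def IsEDSPOutput (N : Network V E) (u v : V) (o : Option (List E × List E)) : Prop :=
  IsMinOutput (N.IsEdgeDisjointPair u v) (fun q => pathSum N.w q.1 + pathSum N.w q.2) o

/-- Possible answers of a shortest-path procedure from `s` to `t`. -/
def IsShortestPathOutput (N : Network V E) (s t : V) (o : Option (List E)) : Prop :=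
  IsMinOutput (N.IsSimplePath s t) (pathSum N.w) o

/-- Links of the transformed network, built from a set `A` of links, a set `B` of nodes and a table
`D` of answers of the Edge-Disjoint Shortest Pair procedure: a simple link for every link in `A`, and
a disjoint link from `u` to `v` for all `u, v ∈ B` for which the procedure found a pair `q`. -/
inductive TLink (A : Set E) (B : Set V) (D : V → V → Option (List E × List E))
  | simple (e : E) (he : e ∈ A) : TLink A B D
  | disjoint (u v : V) (q : List E × List E) (hu : u ∈ B) (hv : v ∈ B) (hq : D u v = some q) :
      TLink A B D

section Transformed

variable {A : Set E} {B : Set V} {D : V → V → Option (List E × List E)}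

/-- Tail node of a link of the transformed network. -/
def tsrc (N : Network V E) : TLink A B D → V
  | .simple e _ => N.src e
  | .disjoint u _ _ _ _ _ => u

/-- Head node of a link of the transformed network. -/
def ttgt (N : Network V E) : TLink A B D → V
  | .simple e _ => N.tgt e
  | .disjoint _ v _ _ _ _ => v

/-- The transformed network; its nodes are those of the original network. -/
def transformed (N : Network V E) (A : Set E) (B : Set V) (D : V → V → Option (List E × List E)) :
    LinkGraph V (TLink A B D) where
  src := N.tsrc
  tgt := N.ttgt

/-- Length in the transformed network: `k * w e` for a simple link (`k = 1` for CO, `k = 2` for CT),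
total weight of the pair for a disjoint link. -/
noncomputable def tlength (N : Network V E) (k : ℝ) : TLink A B D → ℝ
  | .simple e _ => k * N.w e
  | .disjoint _ _ q _ _ _ => pathSum N.w q.1 + pathSum N.w q.2

/-- Time in the transformed network. -/
noncomputable def ttime (N : Network V E) : TLink A B D → ℝ
  | .simple e _ => -Real.log (1 - N.p e)
  | .disjoint _ _ _ _ _ _ => 0

/-- Stage 3: `Construct γ c` holds if `c = (π₁, π₂)` arises from the path `γ` of the transformed
network by putting the link of every simple link into both paths and, for every disjoint link, one
path of its pair into `π₁` and the other one into `π₂`. -/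
inductive Construct : List (TLink A B D) → List E × List E → Prop
  | nil : Construct [] ([], [])
  | simple (e : E) (he : e ∈ A) (γ : List (TLink A B D)) (π₁ π₂ : List E) :
      Construct γ (π₁, π₂) → Construct (.simple e he :: γ) (e :: π₁, e :: π₂)
  | disjoint (u v : V) (q : List E × List E) (hu : u ∈ B) (hv : v ∈ B) (hq : D u v = some q)
      (γ : List (TLink A B D)) (π₁ π₂ : List E) :
      Construct γ (π₁, π₂) → Construct (.disjoint u v q hu hv hq :: γ) (q.1 ++ π₁, q.2 ++ π₂)
  | disjoint_swap (u v : V) (q : List E × List E) (hu : u ∈ B) (hv : v ∈ B) (hq : D u v = some q)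
      (γ : List (TLink A B D)) (π₁ π₂ : List E) :
      Construct γ (π₁, π₂) → Construct (.disjoint u v q hu hv hq :: γ) (q.2 ++ π₁, q.1 ++ π₂)

end Transformed

/-- Stages 1 to 3, with simple links for the links in `A`, disjoint links between the nodes in `B`, and
lengths of simple links multiplied by `k`. `N.TSCMQStages A B k s t S o` holds if `o` is the outcome
of some run; `none` means "Fail". The runs differ in which minimizers the subroutines return and in
how the two paths of a disjoint link are distributed in stage 3. -/
inductive TSCMQStages (N : Network V E) (A : Set E) (B : Set V) (k : ℝ) (s t : V) (S : ℝ) :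
    Option (List E × List E) → Prop
  | fail (D : V → V → Option (List E × List E))
      (stage1 : ∀ u ∈ B, ∀ v ∈ B, N.IsEDSPOutput u v (D u v))
      (stage2 : IsRSPOutput (N.transformed A B D) (N.tlength k) N.ttime (-Real.log S) s t none) :
      TSCMQStages N A B k s t S none
  | success (D : V → V → Option (List E × List E))
      (stage1 : ∀ u ∈ B, ∀ v ∈ B, N.IsEDSPOutput u v (D u v))
      (γ : List (TLink A B D))
      (stage2 : IsRSPOutput (N.transformed A B D) (N.tlength k) N.ttime (-Real.log S) s t (some γ))
      (c : List E × List E) (stage3 : Construct γ c) :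
      TSCMQStages N A B k s t S (some c)

/-- `o` is a possible outcome of the CO-TSCMQ algorithm (`none` means "Fail"). -/
def COTSCMQ (N : Network V E) (s t : V) (S : ℝ) (o : Option (List E × List E)) : Prop :=
  N.TSCMQStages Set.univ Set.univ 1 s t S o

/-- `o` is a possible outcome of the CT-TSCMQ algorithm (`none` means "Fail"): stage 0 finds a
weight-shortest path from `s` to `t` (and the algorithm fails if there is none), to whose links and
nodes the transformed network is restricted; simple links have doubled weights. -/
inductive CTTSCMQ (N : Network V E) (s t : V) (S : ℝ) : Option (List E × List E) → Prop
  | fail (stage0 : N.IsShortestPathOutput s t none) : CTTSCMQ N s t S none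
  | success (πmin : List E) (stage0 : N.IsShortestPathOutput s t (some πmin))
      (o : Option (List E × List E))
      (stages : N.TSCMQStages {e | e ∈ πmin} {v | v ∈ N.nodes s πmin} 2 s t S o) :
      CTTSCMQ N s t S o

end Network

/-! Everything rests on cuts. If links in `C` are counted as safe and `H` contains `C`, call `H`
adequate when every set of nodes separating `s` from `t` is left by a link of `C` or by two links of
`H` (`TwoConnects`). The union of two paths is adequate with their common links as `C`, and so are
the links of any path of the transformed network with its simple links as `C`. Conversely,
`exists_transformed_path` turns an adequate set into a path of the transformed network that is no
longer and uses simple links of `C` only. If all cuts are left twice, Menger's theorem gives one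
disjoint link. Otherwise some cut is left by a single link, which lies in `C`; it becomes a simple
link and both sides of the cut are treated recursively.

For CO this bounds the length optimum by the weight of every feasible connection. For CT the common
links must also lie on the shortest path. Let `f` be the flow of the connection and `g` that of the
shortest path. A unit flow `q` conforming to `f - g` is chosen; then `g + q` has value 2, and its
double links lie on all three paths. Since `f - q` is a nonnegative unit flow, it costs at least as
much as `g`, so `g + q` costs at most as much as `f`.

For the output, re-encoding the links of an optimal transformed path shows that none is repeated
(`nodup_links_of_isRSPOutput`), so length and time are exactly weight and log-survivability.
Simplicity follows by comparison with loop-free subpaths: for CT a removed loop lowers the weight;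
for CO a removed link would have to be a common link, and a potential increasing along the simple
links rules out such loops. -/

/-! ### Paths, cuts and potentials -/

namespace LinkGraph

variable {V E : Type*} {G : LinkGraph V E} {s t u v x : V} {π σ : List E}

theorem IsPath.append (h : G.IsPath u v π) (h' : G.IsPath v x σ) : G.IsPath u x (π ++ σ) := by
  induction π generalizing u with
  | nil => cases h; exact h'
  | cons e π ih => exact ⟨h.1, ih h.2⟩

theorem nodes_cons (e : E) : G.nodes u (e :: π) = u :: G.nodes (G.tgt e) π := rfl

theorem IsPath.src_mem_nodes (h : G.IsPath u v π) {e : E} (he : e ∈ π) :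
    G.src e ∈ G.nodes u π := by
  induction π generalizing u with
  | nil => simp at he
  | cons a π ih =>
    rw [nodes_cons]
    rcases List.mem_cons.1 he with rfl | he
    · rw [h.1]; exact List.mem_cons_self
    · exact List.mem_cons_of_mem _ (ih h.2 he)

theorem tgt_mem_nodes {e : E} (he : e ∈ π) : G.tgt e ∈ G.nodes u π :=
  List.mem_cons_of_mem _ (List.mem_map_of_mem he)

theorem start_mem_nodes : u ∈ G.nodes u π := List.mem_cons_self

theorem IsPath.end_mem_nodes (h : G.IsPath u v π) : v ∈ G.nodes u π := by
  induction π generalizing u with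
  | nil => cases h; exact start_mem_nodes
  | cons a π ih => exact List.mem_cons_of_mem _ (ih h.2)

theorem IsSimplePath.nodup (h : G.IsSimplePath u v π) : π.Nodup :=
  (List.nodup_cons.1 h.2).2.of_map

theorem IsSimplePath.exists_sublist_of_mem (h : G.IsSimplePath u v π) (hx : x ∈ G.nodes u π) :
    ∃ σ, σ.Sublist π ∧ G.IsSimplePath x v σ := by
  induction π generalizing u with
  | nil =>
    obtain rfl : x = u := by simpa [nodes] using hx
    exact ⟨[], List.Sublist.refl _, h⟩
  | cons e π ih =>
    rw [nodes_cons] at hx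
    rcases List.mem_cons.1 hx with rfl | hx
    · exact ⟨_, List.Sublist.refl _, h⟩
    · obtain ⟨σ, hσ, hs⟩ := ih ⟨h.1.2, (List.nodup_cons.1 h.2).2⟩ hx
      exact ⟨σ, hσ.cons _, hs⟩

/-- Every path contains a simple path between the same end nodes. -/
theorem IsPath.exists_simple_sublist (h : G.IsPath u v π) :
    ∃ σ, σ.Sublist π ∧ G.IsSimplePath u v σ := by
  induction π generalizing u with
  | nil => exact ⟨[], List.Sublist.refl _, h, by simp [nodes]⟩
  | cons e π ih =>
    obtain ⟨σ, hσ, hs⟩ := ih h.2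
    by_cases hu : u ∈ G.nodes (G.tgt e) σ
    · obtain ⟨ρ, hρ, hr⟩ := hs.exists_sublist_of_mem hu
      exact ⟨ρ, (hρ.trans hσ).cons _, hr⟩
    · exact ⟨e :: σ, hσ.cons_cons _, ⟨h.1, hs.1⟩, List.nodup_cons.2 ⟨hu, hs.2⟩⟩

/-- A link leaves a set of nodes. -/
def Leaves (G : LinkGraph V E) (X : Set V) (e : E) : Prop := G.src e ∈ X ∧ G.tgt e ∉ X

theorem IsPath.exists_leaves (h : G.IsPath s t π) {X : Set V} (hs : s ∈ X) (ht : t ∉ X) :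
    ∃ e ∈ π, G.Leaves X e := by
  induction π generalizing s with
  | nil => cases h; exact absurd hs ht
  | cons e π ih =>
    by_cases he : G.tgt e ∈ X
    · obtain ⟨a, ha, h'⟩ := ih h.2 he
      exact ⟨a, List.mem_cons_of_mem _ ha, h'⟩
    · exact ⟨e, List.mem_cons_self, by rw [Leaves, h.1]; exact ⟨hs, he⟩⟩

/-- The set of nodes reachable from `s` through `F` cannot be left along `F`, so it must contain
`t`. -/
theorem exists_simplePath_of_cuts {F : Set E}
    (h : ∀ X : Set V, s ∈ X → t ∉ X → ∃ e ∈ F, G.Leaves X e) :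
    ∃ π, G.IsSimplePath s t π ∧ ∀ e ∈ π, e ∈ F := by
  have key : ∃ π, G.IsPath s t π ∧ ∀ e ∈ π, e ∈ F := by
    by_contra hn
    obtain ⟨e, he, ⟨π, hπ, hF⟩, h2⟩ :=
      h {v | ∃ π, G.IsPath s v π ∧ ∀ e ∈ π, e ∈ F} ⟨[], rfl, by simp⟩ hn
    refine h2 ⟨π ++ [e], hπ.append ⟨rfl, rfl⟩, fun a ha => ?_⟩
    rcases List.mem_append.1 ha with ha | ha
    · exact hF a ha
    · rwa [List.mem_singleton.1 ha]
  obtain ⟨π, hπ, hF⟩ := key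
  obtain ⟨σ, hσ, hs⟩ := hπ.exists_simple_sublist
  exact ⟨σ, hs, fun e he => hF e (hσ.subset he)⟩

/-- Along a simple path some potential increases strictly. -/
theorem IsSimplePath.exists_potential (h : G.IsSimplePath u v π) :
    ∃ φ : V → ℤ, ∀ e ∈ π, φ (G.src e) < φ (G.tgt e) := by
  classical
  induction π generalizing u with
  | nil => exact ⟨0, by simp⟩
  | cons a π ih =>
    have hn := List.nodup_cons.1 h.2
    obtain ⟨φ, hφ⟩ := ih ⟨h.1.2, hn.2⟩
    have hne : ∀ y ∈ G.nodes (G.tgt a) π, y ≠ u := fun y hy he => hn.1 (he ▸ hy)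
    -- A simple path never returns to `u`, so the value there is free and only has to lie below that
    -- of the next node.
    refine ⟨Function.update φ u (φ (G.tgt a) - 1), fun e he => ?_⟩
    rcases List.mem_cons.1 he with rfl | he
    · rw [h.1.1, Function.update_self, Function.update_of_ne (hne _ start_mem_nodes)]
      omega
    · rw [Function.update_of_ne (hne _ (h.1.2.src_mem_nodes he)),
        Function.update_of_ne (hne _ (tgt_mem_nodes he))]
      exact hφ e he

/-- Two nodes are joined by finitely many simple paths. -/
theorem finite_simplePaths [Finite V] [Finite E] : {π | G.IsSimplePath u v π}.Finite := by
  have := Fintype.ofFinite E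
  refine (List.finite_length_le E (Fintype.card E)).subset fun π hπ => ?_
  exact List.Nodup.length_le_card (IsSimplePath.nodup hπ)

/-! ### Integral flows and Menger's theorem for two paths -/

section Flow

variable [Fintype E] {f g : E → ℤ} {k l : ℤ}

/-- `f` is an integral flow of value `k` from `s` to `t`, tested against all node potentials. -/
def IsFlow (G : LinkGraph V E) (f : E → ℤ) (k : ℤ) (s t : V) : Prop :=
  ∀ φ : V → ℤ, ∑ e, f e * (φ (G.src e) - φ (G.tgt e)) = k * (φ s - φ t)

theorem IsFlow.add (hf : G.IsFlow f k s t) (hg : G.IsFlow g l s t) :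
    G.IsFlow (fun e => f e + g e) (k + l) s t := fun φ => by
  simp only [add_mul, Finset.sum_add_distrib, hf φ, hg φ]

theorem IsFlow.sub (hf : G.IsFlow f k s t) (hg : G.IsFlow g l s t) :
    G.IsFlow (fun e => f e - g e) (k - l) s t := fun φ => by
  simp only [sub_mul, Finset.sum_sub_distrib, hf φ, hg φ]

theorem IsPath.isFlow [DecidableEq E] (h : G.IsPath s t π) :
    G.IsFlow (fun e => (π.count e : ℤ)) 1 s t := by
  intro φ
  induction π generalizing s with
  | nil => cases h; simp
  | cons a π ih =>
    have h1 := ih h.2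
    have h2 : ∀ e, ((a :: π).count e : ℤ) = (π.count e : ℤ) + if a = e then 1 else 0 := by
      intro e; rw [List.count_cons]; push_cast; simp
    simp only [h2, add_mul, Finset.sum_add_distrib, h1, ite_mul, one_mul, zero_mul,
      Finset.sum_ite_eq, Finset.mem_univ, if_true, h.1]
    ring

theorem IsSimplePath.exists_unit_flow (h : G.IsSimplePath s t π) :
    ∃ c : E → ℤ, G.IsFlow c 1 s t ∧ (∀ e, 0 ≤ c e) ∧ (∀ e, c e ≤ 1) ∧ ∀ e, 0 < c e → e ∈ π := by
  classical
  exact ⟨_, h.1.isFlow, fun e => Int.natCast_nonneg _,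
    fun e => by exact_mod_cast List.nodup_iff_count_le_one.1 h.nodup e,
    fun e he => List.count_pos_iff.1 (by exact_mod_cast he)⟩

/-- A path is determined by a subpath if the missing links increase a potential. -/
theorem IsPath.eq_of_sublist (h : G.IsPath s t π) (h' : G.IsPath s t σ) (hσ : σ.Sublist π) [DecidableEq E]
    {φ : V → ℤ} (hφ : ∀ e, σ.count e ≠ π.count e → φ (G.src e) < φ (G.tgt e)) : σ = π := by
  -- The difference of the two paths is a circulation. Tested against `φ`, its terms are nonpositive
  -- with sum zero, so all vanish.
  have h0 := h.isFlow.sub h'.isFlow φ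
  rw [sub_self, zero_mul] at h0
  have hle : ∀ e, σ.count e ≤ π.count e := fun e => hσ.count_le e
  have hz := (Finset.sum_eq_zero_iff_of_nonpos (fun e _ => by
    by_cases hc : σ.count e = π.count e
    · simp [hc]
    · exact mul_nonpos_of_nonneg_of_nonpos (sub_nonneg.2 (by exact_mod_cast hle e))
        (by linarith [hφ e hc]))).1 h0
  have hcount : ∀ e, σ.count e = π.count e := fun e => by
    by_contra hc
    rcases mul_eq_zero.1 (hz e (Finset.mem_univ e)) with h1 | h1
    · exact hc (by dsimp only at h1; omega)
    · linarith [hφ e hc]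
  exact hσ.eq_of_length (List.perm_iff_count.2 hcount).length_eq

-- Net flow across a cut, obtained by testing against the indicator of `X`.
open Classical in
theorem IsFlow.sum_cut (hf : G.IsFlow f k s t) {X : Set V} (hs : s ∈ X) (ht : t ∉ X) :
    ∑ e, f e * ((if G.src e ∈ X then 1 else 0) - (if G.tgt e ∈ X then 1 else 0)) = k := by
  simpa [hs, ht] using hf (fun v => if v ∈ X then 1 else 0)

theorem IsFlow.exists_crossing (hf : G.IsFlow f k s t) (hk : 0 < k) {X : Set V} (hs : s ∈ X)
    (ht : t ∉ X) : (∃ e, 0 < f e ∧ G.Leaves X e) ∨ ∃ e, f e < 0 ∧ G.Leaves Xᶜ e := by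
  classical
  have h := hf.sum_cut hs ht
  obtain ⟨e, -, he⟩ := Finset.exists_lt_of_sum_lt
    (s := Finset.univ) (f := fun _ : E => (0 : ℤ)) (hk.trans_eq h.symm |>.trans_eq' (by simp))
  by_cases h1 : G.src e ∈ X <;> by_cases h2 : G.tgt e ∈ X <;> simp [h1, h2] at he
  · exact Or.inl ⟨e, he, h1, h2⟩
  · exact Or.inr ⟨e, he, h1, not_not.2 h2⟩

theorem IsFlow.exists_leaves (hf : G.IsFlow f k s t) (hk : 0 < k) (h0 : ∀ e, 0 ≤ f e) {X : Set V}
    (hs : s ∈ X) (ht : t ∉ X) : ∃ e, 0 < f e ∧ G.Leaves X e := by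
  rcases hf.exists_crossing hk hs ht with h | ⟨e, he, -⟩
  · exact h
  · exact absurd (h0 e) (not_le.2 he)

/-- A single leaving link with flow at most one could not carry net flow 2, since entering links
only subtract. -/
theorem IsFlow.exists_two_leaves (hf : G.IsFlow f 2 s t) (h0 : ∀ e, 0 ≤ f e) {X : Set V}
    (hs : s ∈ X) (ht : t ∉ X) : (∃ e, 2 ≤ f e ∧ G.Leaves X e) ∨
      ∃ e e', e ≠ e' ∧ 0 < f e ∧ 0 < f e' ∧ G.Leaves X e ∧ G.Leaves X e' := by
  classical
  obtain ⟨e, he, hl⟩ := hf.exists_leaves two_pos h0 hs ht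
  by_contra! hn
  have h := hf.sum_cut hs ht
  have h1 : f e ≤ 1 := by have := hn.1 e; by_contra hc; exact this (by omega) hl
  rw [← Finset.add_sum_erase _ _ (Finset.mem_univ e)] at h
  have h2 : ∑ a ∈ Finset.univ.erase e,
      f a * ((if G.src a ∈ X then 1 else 0) - (if G.tgt a ∈ X then 1 else 0)) ≤ 0 := by
    refine Finset.sum_nonpos fun a ha => ?_
    have hae := Finset.ne_of_mem_erase ha
    by_cases h3 : G.src a ∈ X <;> by_cases h4 : G.tgt a ∈ X <;> simp [h3, h4, h0 a]
    by_contra hc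
    exact hn.2 e a hae.symm he (by omega) hl ⟨h3, h4⟩
  rw [if_pos hl.1, if_neg hl.2] at h
  linarith

/-- A nonnegative flow of positive value carries a simple path. -/
theorem IsFlow.exists_simplePath (hf : G.IsFlow f k s t) (hk : 0 < k) (h0 : ∀ e, 0 ≤ f e) :
    ∃ π, G.IsSimplePath s t π ∧ ∀ e ∈ π, 0 < f e :=
  exists_simplePath_of_cuts (F := {e | 0 < f e}) fun _ hs ht => hf.exists_leaves hk h0 hs ht

/-- The graph in which links may be traversed forwards (`true`) and backwards (`false`). -/
def residual (G : LinkGraph V E) : LinkGraph V (E × Bool) where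
  src a := if a.2 then G.src a.1 else G.tgt a.1
  tgt a := if a.2 then G.tgt a.1 else G.src a.1

/-- If every cut can be left along a link of `F` or against a link of `R`, there is a unit flow with
values in `{-1, 0, 1}` that is positive only on `F` and negative only on `R`. -/
theorem exists_signed_unit_flow {F R : Set E}
    (h : ∀ X : Set V, s ∈ X → t ∉ X →
      (∃ e ∈ F, G.Leaves X e) ∨ ∃ e ∈ R, G.Leaves Xᶜ e) :
    ∃ f : E → ℤ, G.IsFlow f 1 s t ∧ (∀ e, f e ≤ 1) ∧ (∀ e, -1 ≤ f e) ∧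
      (∀ e, 0 < f e → e ∈ F) ∧ ∀ e, f e < 0 → e ∈ R := by
  classical
  obtain ⟨π, hπ, hF⟩ := exists_simplePath_of_cuts (G := G.residual) (s := s) (t := t)
    (F := {a | if a.2 then a.1 ∈ F else a.1 ∈ R}) (by
      intro X hs ht
      rcases h X hs ht with ⟨e, he, h1, h2⟩ | ⟨e, he, h1, h2⟩
      · exact ⟨(e, true), by simpa using he, by simpa [residual] using h1,
          by simpa [residual] using h2⟩
      · exact ⟨(e, false), by simpa using he, by simpa [residual] using h2,
          by simpa [residual] using h1⟩)
  obtain ⟨c, hc, h0, h1, hcπ⟩ : ∃ c : E × Bool → ℤ, G.residual.IsFlow c 1 s t ∧ (∀ a, 0 ≤ c a) ∧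
      (∀ a, c a ≤ 1) ∧ ∀ a, 0 < c a → a ∈ π :=
    hπ.exists_unit_flow
  -- The two directions of a link cancel, so a positive value needs a forward traversal and a
  -- negative one a backward traversal.
  refine ⟨fun e => c (e, true) - c (e, false), fun φ => ?_, fun e => ?_, fun e => ?_,
    fun e he => ?_, fun e he => ?_⟩
  · rw [← hc φ, Fintype.sum_prod_type]
    refine Finset.sum_congr rfl fun e _ => ?_
    simp only [residual, Fintype.sum_bool, if_true, Bool.false_eq_true, if_false]
    ring
  · linarith [h1 (e, true), h0 (e, false)]
  · linarith [h0 (e, true), h1 (e, false)]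
  · simpa using hF (e, true) (hcπ _ (by linarith [h0 (e, false)]))
  · simpa using hF (e, false) (hcπ _ (by linarith [h0 (e, true)]))

/-- Menger's theorem for two link-disjoint paths. -/
theorem exists_disjoint_simplePaths {H : Set E}
    (h : ∀ X : Set V, s ∈ X → t ∉ X →
      ∃ e ∈ H, ∃ e' ∈ H, e ≠ e' ∧ G.Leaves X e ∧ G.Leaves X e') :
    ∃ π σ, G.IsSimplePath s t π ∧ G.IsSimplePath s t σ ∧ π.Disjoint σ ∧
      (∀ e ∈ π, e ∈ H) ∧ ∀ e ∈ σ, e ∈ H := by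
  classical
  obtain ⟨ρ, hρ, hρH⟩ := exists_simplePath_of_cuts (F := H) (fun X hs ht => by
    obtain ⟨e, he, -, -, -, hl, -⟩ := h X hs ht
    exact ⟨e, he, hl⟩)
  have hρc : ∀ e, ρ.count e ≤ 1 := List.nodup_iff_count_le_one.1 hρ.nodup
  -- Augmentation of `ρ`. Were it blocked at a cut `X`, both given links would lie on `ρ` and `ρ`
  -- would never re-enter `X`, although its net crossing is 1.
  obtain ⟨q, hq, hq1, hq2, hqF, hqR⟩ := exists_signed_unit_flow (G := G) (s := s) (t := t)
    (F := {e | e ∈ H ∧ e ∉ ρ}) (R := {e | e ∈ ρ}) (by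
      intro X hs ht
      by_contra! hn
      obtain ⟨e, he, e', he', hne, hl, hl'⟩ := h X hs ht
      have h1 : e ∈ ρ := by by_contra hc; exact hn.1 e ⟨he, hc⟩ hl
      have h2 : e' ∈ ρ := by by_contra hc; exact hn.1 e' ⟨he', hc⟩ hl'
      have hsum := hρ.1.isFlow.sum_cut hs ht
      have hnn : ∀ a, 0 ≤ (ρ.count a : ℤ) *
          ((if G.src a ∈ X then 1 else 0) - (if G.tgt a ∈ X then 1 else 0)) := by
        intro a
        by_cases ha : a ∈ ρ
        · have := hn.2 a ha
          by_cases h3 : G.src a ∈ X <;> by_cases h4 : G.tgt a ∈ X <;>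
            simp [h3, h4, Leaves] at this ⊢
        · simp [List.count_eq_zero_of_not_mem ha]
      have hle := Finset.sum_le_sum_of_subset_of_nonneg (Finset.subset_univ {e, e'})
        (fun a _ _ => hnn a)
      rw [hsum, Finset.sum_pair hne] at hle
      simp [hl.1, hl.2, hl'.1, hl'.2] at hle
      have := List.count_pos_iff.2 h1
      have := List.count_pos_iff.2 h2
      omega)
  have hf := hρ.1.isFlow.add hq
  have hfH : ∀ e, 0 < (ρ.count e : ℤ) + q e → e ∈ H := fun e he => by
    by_cases h1 : e ∈ ρ
    · exact hρH e h1
    · rw [List.count_eq_zero_of_not_mem h1] at he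
      exact (hqF e (by simpa using he)).1
  have hf0 : ∀ e, 0 ≤ (ρ.count e : ℤ) + q e := fun e => by
    by_cases h1 : q e < 0
    · have := List.count_pos_iff.2 (show e ∈ ρ from hqR e h1)
      have := hq2 e
      omega
    · omega
  have hf1 : ∀ e, (ρ.count e : ℤ) + q e ≤ 1 := fun e => by
    by_cases h1 : 0 < q e
    · rw [List.count_eq_zero_of_not_mem (hqF e h1).2]; simpa using hq1 e
    · have := hρc e
      omega
  obtain ⟨π, hπ, hπf⟩ := hf.exists_simplePath (by norm_num) hf0
  have hπc : ∀ e, π.count e ≤ 1 := List.nodup_iff_count_le_one.1 hπ.nodup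
  -- The augmented flow is at most 1 everywhere, so nothing remains on the links of `π` and `σ`
  -- avoids them.
  obtain ⟨σ, hσ, hσf⟩ := (hf.sub hπ.1.isFlow).exists_simplePath (by norm_num) (fun e => by
    by_cases h1 : e ∈ π
    · have := hπf e h1
      have := hπc e
      omega
    · rw [List.count_eq_zero_of_not_mem h1]; simpa using hf0 e)
  refine ⟨π, σ, hπ, hσ, fun e h1 h2 => ?_, fun e he => hfH e (hπf e he), fun e he => hfH e ?_⟩
  · have := hσf e h2
    have := hf1 e
    have := List.count_pos_iff.2 h1
    omega
  · have := hσf e he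
    omega

end Flow

end LinkGraph

/-! ### Existence of minimizers; sums over lists and over their supports -/

section Auxiliary

variable {α E : Type*}

/-- A minimization problem has an outcome if some finite set contains a feasible object at least as
good as any given one. -/
theorem exists_isMinOutput {feas : α → Prop} {cost : α → ℝ} {F : Set α} (hF : F.Finite)
    (h : ∀ a, feas a → ∃ b ∈ F, feas b ∧ cost b ≤ cost a) : ∃ o, IsMinOutput feas cost o := by
  by_cases hne : ∃ a, feas a
  · obtain ⟨a, ha⟩ := hne
    obtain ⟨b, hb, hfb, -⟩ := h a ha
    obtain ⟨m, ⟨-, hm⟩, hmin⟩ :=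
      Set.exists_min_image (F ∩ {a | feas a}) cost (hF.inter_of_left _) ⟨b, hb, hfb⟩
    refine ⟨some m, hm, fun x hx => ?_⟩
    obtain ⟨y, hy, hfy, hle⟩ := h x hx
    exact (hmin y ⟨hy, hfy⟩).trans hle
  · exact ⟨none, fun a ha => hne ⟨a, ha⟩⟩

variable {f : E → ℝ} {π σ : List E}

@[simp] theorem pathSum_nil : pathSum f [] = 0 := rfl

@[simp] theorem pathSum_cons (e : E) : pathSum f (e :: π) = f e + pathSum f π := by
  simp [pathSum]

@[simp] theorem pathSum_append : pathSum f (π ++ σ) = pathSum f π + pathSum f σ := by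
  simp [pathSum]

theorem pathSum_perm (h : π.Perm σ) : pathSum f π = pathSum f σ := (h.map f).sum_eq

theorem pathSum_nonneg (h0 : ∀ e, 0 ≤ f e) : 0 ≤ pathSum f π :=
  List.sum_nonneg (by simpa using fun e _ => h0 e)

theorem pathSum_le_of_sublist (h0 : ∀ e, 0 ≤ f e) (h : σ.Sublist π) :
    pathSum f σ ≤ pathSum f π := by
  induction h with
  | slnil => exact le_rfl
  | cons a _ ih => rw [pathSum_cons]; linarith [h0 a]
  | cons_cons a _ ih => simpa using ih

theorem pathSum_add_le_of_sublist (h0 : ∀ e, 0 ≤ f e) (h : σ.Sublist π) {x : E} (hx : x ∈ π)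
    (hx' : x ∉ σ) : pathSum f σ + f x ≤ pathSum f π := by
  induction h with
  | slnil => simp at hx
  | cons a h ih =>
    rw [pathSum_cons]
    rcases List.mem_cons.1 hx with rfl | hx
    · linarith [pathSum_le_of_sublist h0 h]
    · linarith [ih hx hx', h0 a]
  | cons_cons a h ih =>
    rw [List.mem_cons, not_or] at hx'
    rw [pathSum_cons, pathSum_cons]
    linarith [ih ((List.mem_cons.1 hx).resolve_left hx'.1) hx'.2]

theorem eq_of_sublist_of_pathSum_le (h0 : ∀ e, 0 < f e) (h : σ.Sublist π)
    (hle : pathSum f π ≤ pathSum f σ) : σ = π := by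
  induction h with
  | slnil => rfl
  | cons a h ih =>
    rw [pathSum_cons] at hle
    linarith [h0 a, pathSum_le_of_sublist (fun e => (h0 e).le) h]
  | cons_cons a h ih =>
    rw [pathSum_cons, pathSum_cons] at hle
    rw [ih (by linarith)]

variable [DecidableEq E]

theorem sum_toFinset_eq_pathSum (h : π.Nodup) : ∑ e ∈ π.toFinset, f e = pathSum f π :=
  List.sum_toFinset f h

theorem sum_toFinset_le_pathSum (h0 : ∀ e, 0 ≤ f e) : ∑ e ∈ π.toFinset, f e ≤ pathSum f π := by
  induction π with
  | nil => simp
  | cons a π ih =>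
    rw [List.toFinset_cons, pathSum_cons]
    by_cases ha : a ∈ π.toFinset
    · rw [Finset.insert_eq_of_mem ha]; linarith [h0 a]
    · rw [Finset.sum_insert ha]; linarith

theorem nodup_of_pathSum_le_sum_toFinset (h0 : ∀ e, 0 < f e)
    (h : pathSum f π ≤ ∑ e ∈ π.toFinset, f e) : π.Nodup := by
  induction π with
  | nil => simp
  | cons a π ih =>
    have hle := sum_toFinset_le_pathSum (π := π) fun e => (h0 e).le
    rw [List.toFinset_cons, pathSum_cons] at h
    by_cases ha : a ∈ π.toFinset
    · rw [Finset.insert_eq_of_mem ha] at h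
      linarith [h0 a]
    · rw [Finset.sum_insert ha] at h
      exact List.nodup_cons.2 ⟨by simpa using ha, ih (by linarith)⟩

end Auxiliary

/-! ### The transformed network and existence of outcomes -/

namespace Network

variable {V E : Type*} {A : Set E} {B : Set V} {D : V → V → Option (List E × List E)}

/-- The links occurring in the simple links of a path of the transformed network. -/
def simpleLinks : List (TLink A B D) → List E
  | [] => []
  | .simple e _ :: γ => e :: simpleLinks γ
  | .disjoint _ _ _ _ _ _ :: γ => simpleLinks γ

/-- The links occurring in the disjoint links of a path of the transformed network. -/
def disjointLinks : List (TLink A B D) → List E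
  | [] => []
  | .simple _ _ :: γ => disjointLinks γ
  | .disjoint _ _ q _ _ _ :: γ => q.1 ++ q.2 ++ disjointLinks γ

variable {N : Network V E} {γ : List (TLink A B D)} {c : List E × List E} {s t : V} {k S : ℝ}

theorem tlength_eq : pathSum (N.tlength k) γ =
    k * pathSum N.w (simpleLinks γ) + pathSum N.w (disjointLinks γ) := by
  induction γ with
  | nil => simp [simpleLinks, disjointLinks]
  | cons x γ ih =>
    rw [pathSum_cons, ih]
    cases x <;> simp [tlength, simpleLinks, disjointLinks] <;> ring

theorem ttime_eq : pathSum N.ttime γ =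
    pathSum (fun e => -Real.log (1 - N.p e)) (simpleLinks γ) := by
  induction γ with
  | nil => simp [simpleLinks]
  | cons x γ ih =>
    rw [pathSum_cons, ih]
    cases x <;> simp [ttime, simpleLinks]

theorem mem_simpleLinks {e : E} :
    e ∈ simpleLinks γ ↔ ∃ he : e ∈ A, TLink.simple e he ∈ γ := by
  induction γ with
  | nil => simp [simpleLinks]
  | cons x γ ih => cases x <;> simp [simpleLinks, ih]; grind

theorem mem_disjointLinks_of_mem {u v : V} {q : List E × List E} {hu : u ∈ B} {hv : v ∈ B}
    {hq : D u v = some q} (h : TLink.disjoint u v q hu hv hq ∈ γ) {e : E}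
    (he : e ∈ q.1 ∨ e ∈ q.2) : e ∈ disjointLinks γ := by
  induction γ with
  | nil => simp at h
  | cons x γ ih =>
    rcases List.mem_cons.1 h with rfl | h'
    · simp [disjointLinks]; tauto
    · cases x <;> simp [disjointLinks, ih h']

/-- Weight and survivability ignore the order of links, so only this multiset description is needed.
`M₁` and `M₂` are the shares of the disjoint links; it covers every assignment of the pairs. -/
theorem Construct.perm (h : Construct γ c) : ∃ M₁ M₂, c.1.Perm (simpleLinks γ ++ M₁) ∧
    c.2.Perm (simpleLinks γ ++ M₂) ∧ (M₁ ++ M₂).Perm (disjointLinks γ) := by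
  classical
  induction h with
  | nil => exact ⟨[], [], by simp [simpleLinks, disjointLinks]⟩
  | simple e he γ π₁ π₂ h ih =>
    obtain ⟨M₁, M₂, h1, h2, h3⟩ := ih
    exact ⟨M₁, M₂, h1.cons e, h2.cons e, h3⟩
  | disjoint u v q hu hv hq γ π₁ π₂ h ih =>
    obtain ⟨M₁, M₂, h1, h2, h3⟩ := ih
    refine ⟨q.1 ++ M₁, q.2 ++ M₂, ?_, ?_, ?_⟩ <;> refine List.perm_iff_count.2 fun a => ?_ <;>
    · have := h1.count_eq a
      have := h2.count_eq a
      have := h3.count_eq a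
      simp only [simpleLinks, disjointLinks, List.count_append] at *
      omega
  | disjoint_swap u v q hu hv hq γ π₁ π₂ h ih =>
    obtain ⟨M₁, M₂, h1, h2, h3⟩ := ih
    refine ⟨q.2 ++ M₁, q.1 ++ M₂, ?_, ?_, ?_⟩ <;> refine List.perm_iff_count.2 fun a => ?_ <;>
    · have := h1.count_eq a
      have := h2.count_eq a
      have := h3.count_eq a
      simp only [simpleLinks, disjointLinks, List.count_append] at *
      omega

theorem exists_construct (γ : List (TLink A B D)) : ∃ c, Construct γ c := by
  induction γ with
  | nil => exact ⟨_, .nil⟩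
  | cons x γ ih =>
    obtain ⟨⟨π₁, π₂⟩, h⟩ := ih
    cases x with
    | simple e he => exact ⟨_, .simple e he γ π₁ π₂ h⟩
    | disjoint u v q hu hv hq => exact ⟨_, .disjoint u v q hu hv hq γ π₁ π₂ h⟩

/-- The table `D` holds possible answers of the Edge-Disjoint Shortest Pair procedure. -/
def IsTable (N : Network V E) (B : Set V) (D : V → V → Option (List E × List E)) : Prop :=
  ∀ u ∈ B, ∀ v ∈ B, N.IsEDSPOutput u v (D u v)

theorem IsTable.isEdgeDisjointPair (hD : N.IsTable B D) {u v : V} {q : List E × List E}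
    (hu : u ∈ B) (hv : v ∈ B) (hq : D u v = some q) : N.IsEdgeDisjointPair u v q := by
  have h := hD u hu v hv
  rw [hq] at h
  exact h.1

theorem Construct.isPath (hD : N.IsTable B D) (h : Construct γ c)
    (hγ : (N.transformed A B D).IsPath s t γ) : N.IsPath s t c.1 ∧ N.IsPath s t c.2 := by
  induction h generalizing s with
  | nil => exact ⟨hγ, hγ⟩
  | simple e he γ π₁ π₂ h ih => exact ⟨⟨hγ.1, (ih hγ.2).1⟩, ⟨hγ.1, (ih hγ.2).2⟩⟩
  | disjoint u v q hu hv hq γ π₁ π₂ h ih =>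
    obtain ⟨h1, h2, -⟩ := hD.isEdgeDisjointPair hu hv hq
    obtain rfl : u = s := hγ.1
    exact ⟨h1.1.append (ih hγ.2).1, h2.1.append (ih hγ.2).2⟩
  | disjoint_swap u v q hu hv hq γ π₁ π₂ h ih =>
    obtain ⟨h1, h2, -⟩ := hD.isEdgeDisjointPair hu hv hq
    obtain rfl : u = s := hγ.1
    exact ⟨h2.1.append (ih hγ.2).1, h1.1.append (ih hγ.2).2⟩

instance [Finite V] [Finite E] : Finite (TLink A B D) := by
  refine Finite.of_injective (β := E ⊕ V × V) (fun x => match x with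
    | .simple e _ => .inl e
    | .disjoint u v _ _ _ _ => .inr (u, v)) fun x y h => ?_
  cases x with
  | simple e he => cases y <;> simp at h; subst h; rfl
  | disjoint u v q hu hv hq =>
    cases y with
    | simple e he => simp at h
    | disjoint u' v' q' hu' hv' hq' =>
      simp only [Sum.inr.injEq, Prod.mk.injEq] at h
      obtain ⟨rfl, rfl⟩ := h
      obtain rfl : q = q' := Option.some.inj (hq.symm.trans hq')
      rfl

theorem one_sub_p_pos (e : E) : 0 < 1 - N.p e := by
  linarith [N.p_le e, N.pmax_lt_one]

theorem neg_log_nonneg (e : E) : 0 ≤ -Real.log (1 - N.p e) :=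
  neg_nonneg.2 (Real.log_nonpos (one_sub_p_pos e).le (by linarith [N.p_pos e]))

theorem tlength_nonneg (hk : 0 ≤ k) (x : TLink A B D) : 0 ≤ N.tlength k x := by
  cases x with
  | simple e he => exact mul_nonneg hk (N.w_pos e).le
  | disjoint u v q hu hv hq =>
    exact add_nonneg (pathSum_nonneg fun e => (N.w_pos e).le)
      (pathSum_nonneg fun e => (N.w_pos e).le)

theorem ttime_nonneg (x : TLink A B D) : 0 ≤ N.ttime x := by
  cases x with
  | simple e he => exact neg_log_nonneg e
  | disjoint u v q hu hv hq => exact le_rfl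

/-- Lengths and times are nonnegative, so the restricted shortest path may be sought among the
finitely many simple paths. -/
theorem exists_TSCMQStages [Finite V] [Finite E] (N : Network V E) (A : Set E) (B : Set V)
    (hk : 0 ≤ k) (s t : V) (S : ℝ) : ∃ o, N.TSCMQStages A B k s t S o := by
  have hED : ∀ u v, ∃ o, N.IsEDSPOutput u v o := fun u v =>
    exists_isMinOutput ((N.finite_simplePaths (u := u) (v := v)).prod N.finite_simplePaths)
      fun q hq => ⟨q, ⟨hq.1, hq.2.1⟩, hq, le_rfl⟩
  choose D hD using hED
  obtain ⟨o, ho⟩ : ∃ o, IsRSPOutput (N.transformed A B D) (N.tlength k) N.ttime (-Real.log S) s t o :=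
    exists_isMinOutput ((N.transformed A B D).finite_simplePaths (u := s) (v := t)) fun γ hγ => by
      obtain ⟨γ', hsub, hs⟩ := hγ.1.exists_simple_sublist
      exact ⟨γ', hs, ⟨hs.1, (pathSum_le_of_sublist ttime_nonneg hsub).trans hγ.2⟩,
        pathSum_le_of_sublist (tlength_nonneg hk) hsub⟩
  cases o with
  | none => exact ⟨none, .fail D (fun u _ v _ => hD u v) ho⟩
  | some γ =>
    obtain ⟨c, hc⟩ := exists_construct γ
    exact ⟨some c, .success D (fun u _ v _ => hD u v) γ ho c hc⟩

end Network

/-! ### From adequate link sets to paths of the transformed network -/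

namespace LinkGraph

variable {V E : Type*} {G : LinkGraph V E} {s t : V}

/-- Every cut between `s` and `t` is left by a link of `C` or by two links of `H`. -/
def TwoConnects (G : LinkGraph V E) (H C : Set E) (s t : V) : Prop :=
  ∀ X : Set V, s ∈ X → t ∉ X → (∃ e ∈ C, G.Leaves X e) ∨
    ∃ e ∈ H, ∃ e' ∈ H, e ≠ e' ∧ G.Leaves X e ∧ G.Leaves X e'

theorem IsPath.twoConnects {π σ : List E} {H C : Set E} (hπ : G.IsPath s t π)
    (hσ : G.IsPath s t σ) (hπH : ∀ e ∈ π, e ∈ H) (hσH : ∀ e ∈ σ, e ∈ H)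
    (hC : ∀ e ∈ π, e ∈ σ → e ∈ C) : G.TwoConnects H C s t := by
  intro X hs ht
  obtain ⟨e, he, hl⟩ := hπ.exists_leaves hs ht
  obtain ⟨e', he', hl'⟩ := hσ.exists_leaves hs ht
  by_cases h : e = e'
  · exact Or.inl ⟨e, hC e he (h ▸ he'), hl⟩
  · exact Or.inr ⟨e, hπH e he, e', hσH e' he', h, hl, hl'⟩

end LinkGraph

theorem Finset.sum_filter_add_sum_filter_le {E : Type*} [DecidableEq E] {H : Finset E} {g : E → ℝ}
    (h0 : ∀ e ∈ H, 0 ≤ g e) {p q : E → Prop} [DecidablePred p] [DecidablePred q] {a : E}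
    (ha : a ∈ H) (hpq : ∀ e, p e → ¬ q e) (hp : ¬ p a) (hq : ¬ q a) :
    ∑ e ∈ H with p e, g e + (g a + ∑ e ∈ H with q e, g e) ≤ ∑ e ∈ H, g e := by
  have hga : g a = ∑ e ∈ H, if e = a then g e else 0 := by simp [ha]
  rw [hga, Finset.sum_filter, Finset.sum_filter, ← Finset.sum_add_distrib,
    ← Finset.sum_add_distrib]
  refine Finset.sum_le_sum fun e he => ?_
  have := h0 e he
  have := hpq e
  by_cases h1 : p e <;> by_cases h2 : q e <;> by_cases h3 : e = a <;> simp_all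

namespace Network

variable {V E : Type*} {A : Set E} {B : Set V} {D : V → V → Option (List E × List E)}
variable {N : Network V E} {γ : List (TLink A B D)} {c : List E × List E} {s t : V} {k S : ℝ}

/-- A link set in which every cut is left by a link of `C` or by two links is traversed by a path of
the transformed network that is at most as long and uses simple links of `C` only. -/
theorem exists_transformed_path [Fintype E] [DecidableEq E] (hD : N.IsTable B D) (b : E → ℝ)
    (H C : Finset E) (hCH : C ⊆ H) (hCA : ∀ e ∈ C, e ∈ A)
    (hAB : ∀ e ∈ A, N.src e ∈ B ∧ N.tgt e ∈ B)
    (hb : ∀ e ∈ H, N.w e ≤ b e) (hbC : ∀ e ∈ C, k * N.w e ≤ b e) (hs : s ∈ B) (ht : t ∈ B)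
    (hcut : N.TwoConnects H C s t) :
    ∃ γ, (N.transformed A B D).IsPath s t γ ∧
      pathSum N.ttime γ ≤ ∑ e ∈ C, -Real.log (1 - N.p e) ∧
      pathSum (N.tlength k) γ ≤ ∑ e ∈ H, b e := by
  classical
  induction H using Finset.strongInduction generalizing C s t with
  | H H ih =>
  have hb0 : ∀ e ∈ H, 0 ≤ b e := fun e he => (N.w_pos e).le.trans (hb e he)
  -- Includes `s = t`, where the condition is vacuous and the disjoint link carries a pair of empty
  -- paths.
  by_cases hM : ∀ X : Set V, s ∈ X → t ∉ X →
      ∃ e ∈ (H : Set E), ∃ e' ∈ (H : Set E), e ≠ e' ∧ N.Leaves X e ∧ N.Leaves X e'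
  · obtain ⟨π, σ, hπ, hσ, hdis, hπH, hσH⟩ := LinkGraph.exists_disjoint_simplePaths hM
    have hst := hD s hs t ht
    cases hq : D s t with
    | none =>
      rw [hq] at hst
      exact absurd ⟨hπ, hσ, hdis⟩ (hst (π, σ))
    | some q =>
      rw [hq] at hst
      refine ⟨[.disjoint s t q hs ht hq], ⟨rfl, rfl⟩, ?_, ?_⟩
      · simpa [ttime] using Finset.sum_nonneg fun e (_ : e ∈ C) => neg_log_nonneg (N := N) e
      · have h1 : pathSum N.w q.1 + pathSum N.w q.2 ≤ pathSum N.w π + pathSum N.w σ :=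
          hst.2 (π, σ) ⟨hπ, hσ, hdis⟩
        have h2 : (π ++ σ).Nodup := List.nodup_append'.2 ⟨hπ.nodup, hσ.nodup, hdis⟩
        have h3 : (π ++ σ).toFinset ⊆ H := fun e he => by
          rcases List.mem_append.1 (List.mem_toFinset.1 he) with he | he
          · exact hπH e he
          · exact hσH e he
        rw [pathSum_cons, pathSum_nil, add_zero]
        calc pathSum N.w q.1 + pathSum N.w q.2
            ≤ pathSum N.w (π ++ σ) := by rw [pathSum_append]; exact h1
          _ = ∑ e ∈ (π ++ σ).toFinset, N.w e := (sum_toFinset_eq_pathSum h2).symm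
          _ ≤ ∑ e ∈ (π ++ σ).toFinset, b e := Finset.sum_le_sum fun e he => hb e (h3 he)
          _ ≤ ∑ e ∈ H, b e := Finset.sum_le_sum_of_subset_of_nonneg h3 fun e he _ => hb0 e he
  · push Not at hM
    obtain ⟨X, hsX, htX, hX⟩ := hM
    obtain ⟨e, he, hl⟩ : ∃ e ∈ C, N.Leaves X e := by
      rcases hcut X hsX htX with h | ⟨e, he, e', he', hne, hl, hl'⟩
      · exact h
      · exact absurd hl' (hX e he e' he' hne hl)
    have huniq : ∀ a ∈ H, N.Leaves X a → a = e := fun a ha hla => by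
      by_contra hne
      exact hX a ha e (hCH he) hne hla hl
    have hsub : ∀ (p : E → Prop) [DecidablePred p], ¬ p e → H.filter p ⊂ H := fun p _ hp =>
      Finset.filter_ssubset.2 ⟨e, hCH he, hp⟩
    obtain ⟨γ₁, hγ₁, ht₁, hl₁⟩ := ih (H.filter fun a => N.src a ∈ X ∧ N.tgt a ∈ X)
      (hsub (fun a => N.src a ∈ X ∧ N.tgt a ∈ X) fun h => hl.2 h.2) (C.filter fun a => N.src a ∈ X ∧ N.tgt a ∈ X)
      (Finset.filter_subset_filter _ hCH) (fun a ha => hCA a (Finset.mem_filter.1 ha).1)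
      (fun a ha => hb a (Finset.mem_filter.1 ha).1)
      (fun a ha => hbC a (Finset.mem_filter.1 ha).1) hs (hAB e (hCA e he)).1 (by
        intro Y hsY heY
        -- Intersecting with `X` uncrosses the cuts: a link leaving `Y ∩ X` and also `X` would be
        -- `e`, whose tail is outside `Y`.
        have hin : ∀ a ∈ H, N.Leaves (Y ∩ X) a →
            (N.src a ∈ X ∧ N.tgt a ∈ X) ∧ N.Leaves Y a := fun a ha hla => by
          have hXa : N.tgt a ∈ X := by
            by_contra hc
            exact heY (huniq a ha ⟨hla.1.2, hc⟩ ▸ hla.1.1)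
          exact ⟨⟨hla.1.2, hXa⟩, hla.1.1, fun hc => hla.2 ⟨hc, hXa⟩⟩
        rcases hcut (Y ∩ X) ⟨hsY, hsX⟩ (fun h => htX h.2) with
          ⟨a, ha, hla⟩ | ⟨a, ha, a', ha', hne, hla, hla'⟩
        · have := hin a (hCH ha) hla
          exact Or.inl ⟨a, Finset.mem_coe.2 (Finset.mem_filter.2 ⟨ha, this.1⟩), this.2⟩
        · have h1 := hin a ha hla
          have h2 := hin a' ha' hla'
          exact Or.inr ⟨a, Finset.mem_coe.2 (Finset.mem_filter.2 ⟨ha, h1.1⟩), a',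
            Finset.mem_coe.2 (Finset.mem_filter.2 ⟨ha', h2.1⟩), hne, h1.2, h2.2⟩)
    obtain ⟨γ₂, hγ₂, ht₂, hl₂⟩ := ih (H.filter fun a => N.src a ∉ X ∧ N.tgt a ∉ X)
      (hsub (fun a => N.src a ∉ X ∧ N.tgt a ∉ X) fun h => h.1 hl.1) (C.filter fun a => N.src a ∉ X ∧ N.tgt a ∉ X)
      (Finset.filter_subset_filter _ hCH) (fun a ha => hCA a (Finset.mem_filter.1 ha).1)
      (fun a ha => hb a (Finset.mem_filter.1 ha).1)
      (fun a ha => hbC a (Finset.mem_filter.1 ha).1) (hAB e (hCA e he)).2 ht (by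
        intro Y heY htY
        -- Dually, a link leaving `X ∪ Y` from within `X` would be `e`, whose head is in `Y`.
        have hin : ∀ a ∈ H, N.Leaves (X ∪ Y) a →
            (N.src a ∉ X ∧ N.tgt a ∉ X) ∧ N.Leaves Y a := fun a ha hla => by
          have h2 := not_or.1 hla.2
          have hXa : N.src a ∉ X := fun hc => h2.2 (huniq a ha ⟨hc, h2.1⟩ ▸ heY)
          exact ⟨⟨hXa, h2.1⟩, hla.1.resolve_left hXa, h2.2⟩
        rcases hcut (X ∪ Y) (Or.inl hsX) (fun h => h.elim htX htY) with
          ⟨a, ha, hla⟩ | ⟨a, ha, a', ha', hne, hla, hla'⟩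
        · have := hin a (hCH ha) hla
          exact Or.inl ⟨a, Finset.mem_coe.2 (Finset.mem_filter.2 ⟨ha, this.1⟩), this.2⟩
        · have h1 := hin a ha hla
          have h2 := hin a' ha' hla'
          exact Or.inr ⟨a, Finset.mem_coe.2 (Finset.mem_filter.2 ⟨ha, h1.1⟩), a',
            Finset.mem_coe.2 (Finset.mem_filter.2 ⟨ha', h2.1⟩), hne, h1.2, h2.2⟩)
    have hsplit : ∀ (F : Finset E) (g : E → ℝ), (∀ a ∈ F, 0 ≤ g a) → e ∈ F →
        ∑ a ∈ F with N.src a ∈ X ∧ N.tgt a ∈ X, g a +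
          (g e + ∑ a ∈ F with N.src a ∉ X ∧ N.tgt a ∉ X, g a) ≤ ∑ a ∈ F, g a :=
      fun F g hg heF => Finset.sum_filter_add_sum_filter_le hg heF (fun a h h' => h'.1 h.1)
        (fun h => hl.2 h.2) (fun h => h.1 hl.1)
    refine ⟨γ₁ ++ .simple e (hCA e he) :: γ₂, hγ₁.append ⟨rfl, hγ₂⟩, ?_, ?_⟩
    · refine le_trans ?_ (hsplit C _ (fun a _ => neg_log_nonneg a) he)
      rw [pathSum_append, pathSum_cons]
      exact add_le_add ht₁ (add_le_add le_rfl ht₂)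
    · refine le_trans ?_ (hsplit H _ hb0 (hCH he))
      rw [pathSum_append, pathSum_cons]
      exact add_le_add hl₁ (add_le_add (hbC e he) hl₂)

/-! ### Every feasible connection is matched by a feasible transformed path -/

theorem sum_neg_log_le [DecidableEq E] (hS : 0 < S) (h : S ≤ N.survivability c) {C : Finset E}
    (hC : C ⊆ c.1.toFinset ∩ c.2.toFinset) :
    ∑ e ∈ C, -Real.log (1 - N.p e) ≤ -Real.log S := by
  refine (Finset.sum_le_sum_of_subset_of_nonneg hC fun e _ _ => neg_log_nonneg e).trans ?_
  rw [Finset.sum_neg_distrib, neg_le_neg_iff, ← Real.log_prod fun e _ => (one_sub_p_pos e).ne']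
  exact Real.log_le_log hS h

theorem exists_transformed_path_le_coWeight [Fintype E] [DecidableEq E]
    {D : V → V → Option (List E × List E)} (hD : N.IsTable Set.univ D) (hS : 0 < S)
    (hc : N.IsSurvivableAtLevel s t S c) :
    ∃ γ, (N.transformed Set.univ Set.univ D).IsPath s t γ ∧ pathSum N.ttime γ ≤ -Real.log S ∧
      pathSum (N.tlength 1) γ ≤ N.coWeight c := by
  obtain ⟨γ, hγ, h1, h2⟩ := exists_transformed_path (A := Set.univ) (k := 1) (s := s) (t := t) hD N.w
    (c.1.toFinset ∪ c.2.toFinset) (c.1.toFinset ∩ c.2.toFinset)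
    (Finset.inter_subset_left.trans Finset.subset_union_left) (fun _ _ => trivial)
    (fun _ _ => ⟨trivial, trivial⟩) (fun _ _ => le_rfl) (fun e _ => (one_mul _).le) trivial trivial
    (hc.1.1.1.twoConnects hc.1.2.1 (by simp +contextual) (by simp +contextual)
      (by simp +contextual))
  exact ⟨γ, hγ, h1.trans (sum_neg_log_le hS hc.2 subset_rfl), h2⟩

theorem sum_count_mul [Fintype E] [DecidableEq E] (f : E → ℝ) (π : List E) :
    ∑ e, (π.count e : ℝ) * f e = pathSum f π := by
  induction π with
  | nil => simp
  | cons a π ih =>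
    simp only [List.count_cons, beq_iff_eq, Nat.cast_add, Nat.cast_ite, Nat.cast_one, Nat.cast_zero,
      add_mul, Finset.sum_add_distrib, ih, ite_mul, one_mul, zero_mul, Finset.sum_ite_eq,
      Finset.mem_univ, if_true, pathSum_cons]
    ring

/-- A nonnegative unit flow costs at least as much as a shortest path. -/
theorem pathSum_le_flow_cost [Fintype E] [DecidableEq E] {πmin : List E}
    (h : N.IsShortestPathOutput s t (some πmin)) {f : E → ℤ} (hf : N.IsFlow f 1 s t)
    (h0 : ∀ e, 0 ≤ f e) : pathSum N.w πmin ≤ ∑ e, (f e : ℝ) * N.w e := by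
  obtain ⟨π, hπ, hπf⟩ := hf.exists_simplePath one_pos h0
  refine (h.2 π hπ).trans ?_
  rw [← sum_count_mul]
  refine Finset.sum_le_sum fun e _ => mul_le_mul_of_nonneg_right ?_ (N.w_pos e).le
  have h1 := List.nodup_iff_count_le_one.1 hπ.nodup e
  have h2 : (π.count e : ℤ) ≤ f e := by
    by_cases he : e ∈ π
    · have := hπf e he
      omega
    · rw [List.count_eq_zero_of_not_mem he]; exact h0 e
  exact_mod_cast h2

theorem exists_transformed_path_le_ctWeight [Fintype E] [DecidableEq E] {πmin : List E}
    (hmin : N.IsShortestPathOutput s t (some πmin)) {D : V → V → Option (List E × List E)}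
    (hD : N.IsTable {v | v ∈ N.nodes s πmin} D) (hS : 0 < S)
    (hc : N.IsSurvivableAtLevel s t S c) :
    ∃ γ, (N.transformed {e | e ∈ πmin} {v | v ∈ N.nodes s πmin} D).IsPath s t γ ∧
      pathSum N.ttime γ ≤ -Real.log S ∧ pathSum (N.tlength 2) γ ≤ N.ctWeight c := by
  obtain ⟨g, hg, hgdef⟩ : ∃ g : E → ℤ, N.IsFlow g 1 s t ∧ ∀ e, g e = πmin.count e :=
    ⟨_, hmin.1.1.isFlow, fun _ => rfl⟩
  obtain ⟨f, hf, hfdef⟩ : ∃ f : E → ℤ, N.IsFlow f 2 s t ∧ ∀ e, f e = c.1.count e + c.2.count e :=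
    ⟨_, hc.1.1.1.isFlow.add hc.1.2.1.isFlow, fun _ => rfl⟩
  have hcount : ∀ {π}, N.IsSimplePath s t π → ∀ e, π.count e ≤ 1 := fun h =>
    List.nodup_iff_count_le_one.1 h.nodup
  -- `q` has the signs of `f - g`, which has value 1. This keeps both `g + q` and `f - q`
  -- nonnegative.
  obtain ⟨q, hq, hq1, hq2, hqF, hqR⟩ := LinkGraph.exists_signed_unit_flow (G := N.toLinkGraph)
    (s := s) (t := t) (F := {e | 0 < f e - g e}) (R := {e | f e - g e < 0})
    fun X hs ht => (hf.sub hg).exists_crossing (by norm_num) hs ht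
  have hf0 : ∀ e, 0 ≤ f e := fun e => by rw [hfdef]; positivity
  have hg0 : ∀ e, 0 ≤ g e := fun e => by rw [hgdef]; positivity
  have hg1 : ∀ e, g e ≤ 1 := fun e => by rw [hgdef]; exact_mod_cast hcount hmin.1 e
  have hF : ∀ e, 0 < q e → 0 < f e - g e := hqF
  have hR : ∀ e, q e < 0 → f e - g e < 0 := hqR
  have hh0 : ∀ e, 0 ≤ g e + q e := fun e => by
    have := hR e; have := hf0 e; have := hg0 e; have := hq2 e
    omega
  have hfq0 : ∀ e, 0 ≤ f e - q e := fun e => by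
    have := hF e; have := hf0 e; have := hg0 e; have := hq1 e
    omega
  -- Here `g e = q e = 1`, so `f e` exceeds 1 and must be 2.
  have hC : ∀ e, 2 ≤ g e + q e → e ∈ πmin ∧ e ∈ c.1 ∧ e ∈ c.2 := fun e he => by
    have h1 := hF e; have h2 := hg1 e; have h3 := hq1 e
    have h4 := hcount hc.1.1 e; have h5 := hcount hc.1.2 e
    have h6 := hfdef e; have h7 := hgdef e
    exact ⟨List.count_pos_iff.1 (by omega), List.count_pos_iff.1 (by omega),
      List.count_pos_iff.1 (by omega)⟩
  have hh := hg.add hq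
  obtain ⟨γ, hγ, h1, h2⟩ := exists_transformed_path (A := {e | e ∈ πmin}) (k := 2) (s := s) (t := t)
    hD (fun e => ((g e + q e : ℤ) : ℝ) * N.w e) (Finset.univ.filter fun e => 0 < g e + q e)
    (Finset.univ.filter fun e => 2 ≤ g e + q e)
    (Finset.monotone_filter_right _ fun e _ (he : 2 ≤ g e + q e) => show 0 < g e + q e by omega)
    (fun e he => (hC e (Finset.mem_filter.1 he).2).1)
    (fun e he => ⟨hmin.1.1.src_mem_nodes he, LinkGraph.tgt_mem_nodes he⟩)
    (fun e he => by
      have : (1 : ℝ) ≤ ((g e + q e : ℤ) : ℝ) := by exact_mod_cast (Finset.mem_filter.1 he).2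
      exact le_mul_of_one_le_left (N.w_pos e).le this)
    (fun e he => by
      have : (2 : ℝ) ≤ ((g e + q e : ℤ) : ℝ) := by exact_mod_cast (Finset.mem_filter.1 he).2
      exact mul_le_mul_of_nonneg_right this (N.w_pos e).le)
    LinkGraph.start_mem_nodes hmin.1.1.end_mem_nodes (fun X hs ht => by
      rcases hh.exists_two_leaves hh0 hs ht with ⟨e, he, hl⟩ | ⟨e, e', hne, he, he', hl, hl'⟩
      · exact Or.inl ⟨e, by simpa using he, hl⟩
      · exact Or.inr ⟨e, by simpa using he, e', by simpa using he', hne, hl, hl'⟩)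
  refine ⟨γ, hγ, h1.trans (sum_neg_log_le hS hc.2 fun e he => ?_), h2.trans ?_⟩
  · have := hC e (Finset.mem_filter.1 he).2
    simp [this.2]
  · have h3 : ∑ e ∈ Finset.univ.filter (fun e => 0 < g e + q e), ((g e + q e : ℤ) : ℝ) * N.w e ≤
        ∑ e, ((g e + q e : ℤ) : ℝ) * N.w e :=
      Finset.sum_le_sum_of_subset_of_nonneg (Finset.subset_univ _) fun e _ _ =>
        mul_nonneg (by exact_mod_cast hh0 e) (N.w_pos e).le
    -- The cost of `g` is at most that of `f - q`; rearranged, `g + q` costs at most as much as `f`.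
    have h4 := pathSum_le_flow_cost hmin (hf.sub hq) hfq0
    rw [← sum_count_mul] at h4
    have h5 : ∀ e, (πmin.count e : ℝ) = g e := fun e => by rw [hgdef]; simp
    have h6 : N.ctWeight c = ∑ e, (f e : ℝ) * N.w e := by
      rw [ctWeight, ← sum_count_mul, ← sum_count_mul, ← Finset.sum_add_distrib]
      exact Finset.sum_congr rfl fun e _ => by rw [hfdef]; push_cast; ring
    simp only [h5, Int.cast_sub, Int.cast_add, sub_mul, add_mul, Finset.sum_sub_distrib,
      Finset.sum_add_distrib] at h3 h4 ⊢
    linarith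

end Network

/-! ### The constructed pair is a survivable connection -/

namespace Network

variable {V E : Type*} {A : Set E} {B : Set V} {D : V → V → Option (List E × List E)}
variable {N : Network V E} {γ : List (TLink A B D)} {c : List E × List E} {s t : V} {k S : ℝ}

theorem twoConnects_of_transformed_path (hD : N.IsTable B D)
    (hγ : (N.transformed A B D).IsPath s t γ) :
    N.TwoConnects {e | e ∈ simpleLinks γ ++ disjointLinks γ} {e | e ∈ simpleLinks γ} s t := by
  intro X hs ht
  obtain ⟨x, hx, h1, h2⟩ := hγ.exists_leaves hs ht
  cases x with
  | simple e he => exact Or.inl ⟨e, mem_simpleLinks.2 ⟨he, hx⟩, h1, h2⟩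
  | disjoint u v q hu hv hq =>
    obtain ⟨p1, p2, hdis⟩ := hD.isEdgeDisjointPair hu hv hq
    obtain ⟨e, he, hl⟩ := p1.1.exists_leaves (X := X) h1 h2
    obtain ⟨e', he', hl'⟩ := p2.1.exists_leaves (X := X) h1 h2
    exact Or.inr ⟨e, List.mem_append_right _ (mem_disjointLinks_of_mem hx (Or.inl he)), e',
      List.mem_append_right _ (mem_disjointLinks_of_mem hx (Or.inr he')),
      fun h => hdis he (h ▸ he'), hl, hl'⟩

/-- A shortest path of the transformed network uses no link of the network twice. -/
theorem nodup_links_of_isRSPOutput [Fintype E] [DecidableEq E] (hD : N.IsTable B D)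
    (hAB : ∀ e ∈ A, N.src e ∈ B ∧ N.tgt e ∈ B) (hs : s ∈ B) (ht : t ∈ B) (hk : 1 ≤ k)
    (hγ : IsRSPOutput (N.transformed A B D) (N.tlength k) N.ttime (-Real.log S) s t (some γ)) :
    (simpleLinks γ ++ disjointLinks γ).Nodup := by
  have hw : ∀ e, 0 ≤ N.w e := fun e => (N.w_pos e).le
  -- The links of `γ` are re-encoded with each charged once, at the simple-link rate if it occurs in
  -- a simple link. Any repetition would make `γ'` strictly shorter than `γ`.
  obtain ⟨γ', hγ', h1, h2⟩ := exists_transformed_path (A := A) (k := k) (s := s) (t := t) hD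
    (fun e => if e ∈ (simpleLinks γ).toFinset then k * N.w e else N.w e)
    ((simpleLinks γ).toFinset ∪ ((disjointLinks γ).toFinset \ (simpleLinks γ).toFinset))
    (simpleLinks γ).toFinset Finset.subset_union_left
    (fun e he => (mem_simpleLinks.1 (List.mem_toFinset.1 he)).1) hAB
    (fun e _ => by
      split_ifs
      · exact le_mul_of_one_le_left (hw e) hk
      · exact le_rfl)
    (fun e he => by rw [if_pos he]) hs ht (by
      have := twoConnects_of_transformed_path hD hγ.1.1
      rw [Finset.union_sdiff_self_eq_union, ← List.toFinset_append]
      rwa [List.coe_toFinset, List.coe_toFinset])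
  have htime : pathSum N.ttime γ' ≤ -Real.log S := by
    refine (h1.trans (sum_toFinset_le_pathSum neg_log_nonneg)).trans ?_
    rw [← ttime_eq]
    exact hγ.1.2
  have hle := (hγ.2 γ' ⟨hγ', htime⟩).trans h2
  rw [tlength_eq, Finset.sum_union Finset.disjoint_sdiff,
    Finset.sum_congr rfl fun e he => if_pos he,
    Finset.sum_congr rfl fun e he => if_neg (Finset.mem_sdiff.1 he).2, ← Finset.mul_sum] at hle
  have hs1 := sum_toFinset_le_pathSum (π := simpleLinks γ) hw
  have hs2 := sum_toFinset_le_pathSum (π := disjointLinks γ) hw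
  have hs3 : ∑ e ∈ (disjointLinks γ).toFinset \ (simpleLinks γ).toFinset, N.w e ≤
      ∑ e ∈ (disjointLinks γ).toFinset, N.w e :=
    Finset.sum_le_sum_of_subset_of_nonneg Finset.sdiff_subset fun e _ _ => hw e
  have hs4 := mul_le_mul_of_nonneg_left hs1 (zero_le_one.trans hk)
  refine List.nodup_append'.2 ⟨nodup_of_pathSum_le_sum_toFinset N.w_pos ?_,
    nodup_of_pathSum_le_sum_toFinset N.w_pos (by linarith), fun e he he' => ?_⟩
  · exact le_of_mul_le_mul_left (by linarith) (zero_lt_one.trans_le hk)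
  · have : ∑ e ∈ (disjointLinks γ).toFinset \ (simpleLinks γ).toFinset, N.w e <
        ∑ e ∈ (disjointLinks γ).toFinset, N.w e :=
      Finset.sum_lt_sum_of_subset Finset.sdiff_subset (List.mem_toFinset.2 he')
        (by simp [he]) (N.w_pos e) fun e _ _ => hw e
    linarith

theorem Construct.inter_eq [DecidableEq E] (h : Construct γ c)
    (hn : (simpleLinks γ ++ disjointLinks γ).Nodup) :
    c.1.toFinset ∩ c.2.toFinset = (simpleLinks γ).toFinset := by
  obtain ⟨M₁, M₂, h1, h2, h3⟩ := h.perm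
  have hd : M₁.Disjoint M₂ := (List.nodup_append'.1 (h3.nodup_iff.2 (List.nodup_append'.1 hn).2.1)).2.2
  ext e
  have := @hd e
  simp only [Finset.mem_inter, List.mem_toFinset, h1.mem_iff, h2.mem_iff, List.mem_append]
  tauto

theorem Construct.union_eq [DecidableEq E] (h : Construct γ c) :
    c.1.toFinset ∪ c.2.toFinset = (simpleLinks γ ++ disjointLinks γ).toFinset := by
  obtain ⟨M₁, M₂, h1, h2, h3⟩ := h.perm
  ext e
  simp only [Finset.mem_union, List.mem_toFinset, h1.mem_iff, h2.mem_iff, List.mem_append,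
    ← h3.mem_iff]
  tauto

theorem Construct.nodup (h : Construct γ c) (hn : (simpleLinks γ ++ disjointLinks γ).Nodup) :
    c.1.Nodup ∧ c.2.Nodup := by
  obtain ⟨M₁, M₂, h1, h2, h3⟩ := h.perm
  have h4 := (h3.append_left (simpleLinks γ)).nodup_iff.2 hn
  exact ⟨h1.nodup_iff.2 (h4.sublist ((List.sublist_append_left _ _).append_left _)),
    h2.nodup_iff.2 (h4.sublist ((List.sublist_append_right _ _).append_left _))⟩

theorem Construct.coWeight_eq [DecidableEq E] (h : Construct γ c)
    (hn : (simpleLinks γ ++ disjointLinks γ).Nodup) :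
    N.coWeight c = pathSum (N.tlength 1) γ := by
  rw [coWeight, h.union_eq, sum_toFinset_eq_pathSum hn, tlength_eq, pathSum_append, one_mul]

theorem Construct.ctWeight_eq (h : Construct γ c) : N.ctWeight c = pathSum (N.tlength 2) γ := by
  obtain ⟨M₁, M₂, h1, h2, h3⟩ := h.perm
  rw [ctWeight, tlength_eq, pathSum_perm h1, pathSum_perm h2, ← pathSum_perm h3]
  simp only [pathSum_append]
  ring

theorem Construct.le_survivability [DecidableEq E] (h : Construct γ c)
    (hn : (simpleLinks γ ++ disjointLinks γ).Nodup) (hS : 0 < S)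
    (ht : pathSum N.ttime γ ≤ -Real.log S) : S ≤ N.survivability c := by
  rw [ttime_eq, ← sum_toFinset_eq_pathSum (List.nodup_append'.1 hn).1, Finset.sum_neg_distrib,
    neg_le_neg_iff, ← Real.log_prod fun e _ => (one_sub_p_pos e).ne', ← h.inter_eq hn] at ht
  exact (Real.log_le_log_iff hS (Finset.prod_pos fun e _ => one_sub_p_pos e)).1 ht

theorem survivability_le_of_subset [DecidableEq E] {c' : List E × List E} (h1 : c'.1 ⊆ c.1)
    (h2 : c'.2 ⊆ c.2) : N.survivability c ≤ N.survivability c' := by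
  refine Finset.prod_le_prod_of_subset_of_le_one ?_ (fun e _ => (one_sub_p_pos e).le)
    fun e _ _ => by linarith [N.p_pos e]
  exact Finset.inter_subset_inter (fun e he => List.mem_toFinset.2 (h1 (List.mem_toFinset.1 he)))
    fun e he => List.mem_toFinset.2 (h2 (List.mem_toFinset.1 he))

/-- The simple links of a shortest path of the transformed network increase some potential. -/
theorem exists_potential_of_isRSPOutput (hk : 0 < k)
    (hγ : IsRSPOutput (N.transformed A B D) (N.tlength k) N.ttime (-Real.log S) s t (some γ)) :
    ∃ φ : V → ℤ, ∀ e ∈ simpleLinks γ, φ (N.src e) < φ (N.tgt e) := by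
  -- `γ` itself may repeat nodes through zero-length disjoint links of empty pairs, but its simple
  -- links have positive length and so survive in `γ'`.
  obtain ⟨γ', hsub, hs⟩ := hγ.1.1.exists_simple_sublist
  obtain ⟨φ, hφ⟩ := hs.exists_potential
  refine ⟨φ, fun e he => ?_⟩
  obtain ⟨heA, hx⟩ := mem_simpleLinks.1 he
  refine hφ (.simple e heA) ?_
  by_contra hx'
  have h1 := hγ.2 γ' ⟨hs.1, (pathSum_le_of_sublist ttime_nonneg hsub).trans hγ.1.2⟩
  have h2 := pathSum_add_le_of_sublist (tlength_nonneg (N := N) hk.le) hsub hx hx'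
  have h3 : 0 < N.tlength k (.simple e heA : TLink A B D) := mul_pos hk (N.w_pos e)
  linarith

theorem coTSCMQ_isSurvivableAtLevel [Fintype E] [DecidableEq E]
    {D : V → V → Option (List E × List E)} {γ : List (TLink Set.univ Set.univ D)}
    (hD : N.IsTable Set.univ D) (hS : 0 < S)
    (hγ : IsRSPOutput (N.transformed Set.univ Set.univ D) (N.tlength 1) N.ttime (-Real.log S) s t
      (some γ)) (hc : Construct γ c) :
    N.IsSurvivableAtLevel s t S c ∧ N.coWeight c = pathSum (N.tlength 1) γ := by
  have hn := nodup_links_of_isRSPOutput hD (fun _ _ => ⟨trivial, trivial⟩) trivial trivial le_rfl hγ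
  have hsurv := hc.le_survivability hn hS hγ.1.2
  have hw := hc.coWeight_eq (N := N) hn
  have hinter := hc.inter_eq hn
  obtain ⟨hp1, hp2⟩ := hc.isPath hD hγ.1.1
  obtain ⟨π₁, hsub1, hs1⟩ := hp1.exists_simple_sublist
  obtain ⟨π₂, hsub2, hs2⟩ := hp2.exists_simple_sublist
  obtain ⟨φ, hφ⟩ := exists_potential_of_isRSPOutput one_pos hγ
  obtain ⟨γ', hγ', ht', hl'⟩ := exists_transformed_path_le_coWeight (c := (π₁, π₂)) hD hS
    ⟨⟨hs1, hs2⟩, hsurv.trans (survivability_le_of_subset hsub1.subset hsub2.subset)⟩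
  have hle : N.coWeight c ≤ N.coWeight (π₁, π₂) := hw.trans_le ((hγ.2 γ' ⟨hγ', ht'⟩).trans hl')
  -- Losing a link from the union would push the CO-weight below the optimum. A link dropped from
  -- one path therefore remains on the other, hence is common and increases `φ`.
  have hunion : ∀ e, e ∈ c.1 ∨ e ∈ c.2 → e ∈ π₁ ∨ e ∈ π₂ := by
    intro e he
    by_contra hne
    refine absurd hle (not_le.2 (Finset.sum_lt_sum_of_subset (i := e) ?_ (by simpa using he)
      (by simpa using hne) (N.w_pos e) fun a _ _ => (N.w_pos a).le))
    intro a ha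
    simp only [Finset.mem_union, List.mem_toFinset] at ha ⊢
    exact ha.imp (fun h => hsub1.subset h) fun h => hsub2.subset h
  have hsimple : ∀ e, e ∈ c.1 → e ∈ c.2 → φ (N.src e) < φ (N.tgt e) := fun e h1 h2 => by
    refine hφ e (List.mem_toFinset.1 ?_)
    rw [← hinter]
    simp [h1, h2]
  have key : ∀ {π σ : List E}, σ.Sublist π → π.Nodup → (∀ e ∈ π, e ∉ σ →
      φ (N.src e) < φ (N.tgt e)) → ∀ e, σ.count e ≠ π.count e → φ (N.src e) < φ (N.tgt e) := by
    intro π σ hsub hnd h e hne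
    have h1 := hsub.count_le e
    have h2 := List.nodup_iff_count_le_one.1 hnd e
    exact h e (List.count_pos_iff.1 (by omega)) (List.count_eq_zero.1 (by omega))
  have he1 : π₁ = c.1 := hp1.eq_of_sublist hs1.1 hsub1 (key hsub1 (hc.nodup hn).1 fun e he he' =>
    hsimple e he (hsub2.subset ((hunion e (Or.inl he)).resolve_left he')))
  have he2 : π₂ = c.2 := hp2.eq_of_sublist hs2.1 hsub2 (key hsub2 (hc.nodup hn).2 fun e he he' =>
    hsimple e (hsub1.subset ((hunion e (Or.inr he)).resolve_right he')) he)
  exact ⟨⟨⟨he1 ▸ hs1, he2 ▸ hs2⟩, hsurv⟩, hw⟩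

/-- The CT-weight counts each path separately, so any loop removal lowers it strictly and no
potential is needed. -/
theorem ctTSCMQ_isSurvivableAtLevel [Fintype E] [DecidableEq E] {πmin : List E}
    (hmin : N.IsShortestPathOutput s t (some πmin)) {D : V → V → Option (List E × List E)}
    {γ : List (TLink {e | e ∈ πmin} {v | v ∈ N.nodes s πmin} D)}
    (hD : N.IsTable {v | v ∈ N.nodes s πmin} D) (hS : 0 < S)
    (hγ : IsRSPOutput (N.transformed {e | e ∈ πmin} {v | v ∈ N.nodes s πmin} D) (N.tlength 2)
      N.ttime (-Real.log S) s t (some γ)) (hc : Construct γ c) :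
    N.IsSurvivableAtLevel s t S c := by
  have hn := nodup_links_of_isRSPOutput hD
    (fun e he => ⟨hmin.1.1.src_mem_nodes he, LinkGraph.tgt_mem_nodes he⟩)
    LinkGraph.start_mem_nodes hmin.1.1.end_mem_nodes one_le_two hγ
  have hsurv := hc.le_survivability hn hS hγ.1.2
  obtain ⟨hp1, hp2⟩ := hc.isPath hD hγ.1.1
  obtain ⟨π₁, hsub1, hs1⟩ := hp1.exists_simple_sublist
  obtain ⟨π₂, hsub2, hs2⟩ := hp2.exists_simple_sublist
  obtain ⟨γ', hγ', ht', hl'⟩ := exists_transformed_path_le_ctWeight (c := (π₁, π₂)) hmin hD hS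
    ⟨⟨hs1, hs2⟩, hsurv.trans (survivability_le_of_subset hsub1.subset hsub2.subset)⟩
  have hle : N.ctWeight c ≤ N.ctWeight (π₁, π₂) :=
    hc.ctWeight_eq.trans_le ((hγ.2 γ' ⟨hγ', ht'⟩).trans hl')
  have hw : ∀ e, 0 ≤ N.w e := fun e => (N.w_pos e).le
  have hle1 := pathSum_le_of_sublist hw hsub1
  have hle2 := pathSum_le_of_sublist hw hsub2
  dsimp only [ctWeight] at hle
  have he1 : π₁ = c.1 := eq_of_sublist_of_pathSum_le N.w_pos hsub1 (by linarith)
  have he2 : π₂ = c.2 := eq_of_sublist_of_pathSum_le N.w_pos hsub2 (by linarith)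
  exact ⟨⟨he1 ▸ hs1, he2 ▸ hs2⟩, hsurv⟩

/-! ### Correctness of both algorithms -/

theorem COTSCMQ.isMinOutput [Fintype E] [DecidableEq E] (hS : 0 < S)
    {o : Option (List E × List E)} (h : N.COTSCMQ s t S o) :
    IsMinOutput (N.IsSurvivableAtLevel s t S) N.coWeight o := by
  cases h with
  | fail D hD hγ =>
    intro c hc
    obtain ⟨γ, h1, h2, -⟩ := exists_transformed_path_le_coWeight hD hS hc
    exact hγ γ ⟨h1, h2⟩
  | success D hD γ hγ c hc =>
    obtain ⟨hfeas, hw⟩ := coTSCMQ_isSurvivableAtLevel hD hS hγ hc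
    refine ⟨hfeas, fun c' hc' => ?_⟩
    obtain ⟨γ', h1, h2, h3⟩ := exists_transformed_path_le_coWeight hD hS hc'
    exact hw.trans_le ((hγ.2 γ' ⟨h1, h2⟩).trans h3)

theorem CTTSCMQ.isMinOutput [Fintype E] [DecidableEq E] (hS : 0 < S)
    {o : Option (List E × List E)} (h : N.CTTSCMQ s t S o) :
    IsMinOutput (N.IsSurvivableAtLevel s t S) N.ctWeight o := by
  cases h with
  | fail hmin => exact fun c hc => hmin c.1 hc.1.1
  | success πmin hmin o h =>
    cases h with
    | fail D hD hγ =>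
      intro c hc
      obtain ⟨γ, h1, h2, -⟩ := exists_transformed_path_le_ctWeight hmin hD hS hc
      exact hγ γ ⟨h1, h2⟩
    | success D hD γ hγ c hc =>
      refine ⟨ctTSCMQ_isSurvivableAtLevel hmin hD hS hγ hc, fun c' hc' => ?_⟩
      obtain ⟨γ', h1, h2, h3⟩ := exists_transformed_path_le_ctWeight hmin hD hS hc'
      exact hc.ctWeight_eq.trans_le ((hγ.2 γ' ⟨h1, h2⟩).trans h3)

theorem exists_CTTSCMQ [Finite V] [Finite E] (N : Network V E) (s t : V) (S : ℝ) :
    ∃ o, N.CTTSCMQ s t S o := by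
  obtain ⟨o, ho⟩ : ∃ o, N.IsShortestPathOutput s t o :=
    exists_isMinOutput (N.finite_simplePaths (u := s) (v := t)) fun π hπ => ⟨π, hπ, hπ, le_rfl⟩
  cases o with
  | none => exact ⟨none, .fail ho⟩
  | some π =>
    obtain ⟨o, h⟩ := exists_TSCMQStages N {e | e ∈ π} {v | v ∈ N.nodes s π} zero_le_two s t S
    exact ⟨o, .success π ho o h⟩

end Network

theorem IsMinOutput.exists_eq_some {α : Type*} {feas : α → Prop} {cost : α → ℝ} {o : Option α}
    (h : IsMinOutput feas cost o) (hf : ∃ a, feas a) : ∃ a, o = some a ∧ IsMinimizer feas cost a := by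
  cases o with
  | none => exact absurd hf (not_exists.2 h)
  | some a => exact ⟨a, rfl, h⟩

theorem IsMinOutput.eq_none {α : Type*} {feas : α → Prop} {cost : α → ℝ} {o : Option α}
    (h : IsMinOutput feas cost o) (hf : ¬ ∃ a, feas a) : o = none := by
  cases o with
  | none => rfl
  | some a => exact absurd ⟨a, h.1⟩ hf

theorem mainTheorem4 {V E : Type*} [Fintype V] [Fintype E] [DecidableEq E]
    (N : Network V E) (s t : V) (S : ℝ) (hS : S ∈ Set.Icc N.Smin 1) :
    ((∃ o, N.COTSCMQ s t S o) ∧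
      ((∃ c, N.IsSurvivableConnection s t c ∧ S ≤ N.survivability c) →
        ∀ o, N.COTSCMQ s t S o → ∃ c, o = some c ∧ N.IsCOCSMQSolution s t S c) ∧
      ((¬ ∃ c, N.IsSurvivableConnection s t c ∧ S ≤ N.survivability c) →
        ∀ o, N.COTSCMQ s t S o → o = none)) ∧
    ((∃ o, N.CTTSCMQ s t S o) ∧
      ((∃ c, N.IsSurvivableConnection s t c ∧ S ≤ N.survivability c) →
        ∀ o, N.CTTSCMQ s t S o → ∃ c, o = some c ∧ N.IsCTCSMQSolution s t S c) ∧
      ((¬ ∃ c, N.IsSurvivableConnection s t c ∧ S ≤ N.survivability c) →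
        ∀ o, N.CTTSCMQ s t S o → o = none)) := by
  -- Positivity of `S` makes the bound on total time equivalent to the bound on survivability.
  have hS0 : 0 < S := (pow_pos (sub_pos.2 N.pmax_lt_one) _).trans_le hS.1
  exact ⟨⟨Network.exists_TSCMQStages N _ _ zero_le_one s t S,
      fun h _ ho => ho.isMinOutput hS0 |>.exists_eq_some h,
      fun h _ ho => ho.isMinOutput hS0 |>.eq_none h⟩,
    Network.exists_CTTSCMQ N s t S,
    fun h _ ho => ho.isMinOutput hS0 |>.exists_eq_some h,
    fun h _ ho => ho.isMinOutput hS0 |>.eq_none h⟩
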